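/- Consider a traffic diverge with two exit links, indexed by $I=\{1,2\}$. A normalized demand configuration is $F=\{f_1,f_2\}$ with $f_1,f_2\ge 0$ and $f_1+f_2=1$. A flow vector $\mathbf{x}=(x_i^s,x_i^b : i\in I)\in\mathbb{R}^4$ (where $x_i^s$ and $x_i^b$ are the flows of steadfast and of bypassing vehicles with destination $i$) is feasible for $F$ if $x_i^s+x_i^b=f_i$, $x_i^s\ge 0$ and $x_i^b\ge 0$ for every $i\in I$. Given real-valued cost functions $J_i^s,J_i^b$ ($i\in I$) of $\mathbf{x}$, a Wardrop equilibrium is a feasible flow vector $\mathbf{x}$ such that for every $i\in I$ $$x_i^s\,\bigl(J_i^s(\mathbf{x})-J_i^b(\mathbf{x})\bigr)\le 0,\qquad x_i^b\,\bigl(J_i^b(\mathbf{x})-J_i^s(\mathbf{x})\bigr)\le 0 .$$ Then, for every normalized demand configuration $F$: (1) If the cost functions $J_i^s,J_i^b$, $i\in I$, are continuous and elementwise monotone on the set of flow vectors with nonnegative components (that is, $J(\mathbf{x})\le J(\mathbf{x}')$ whenever $0\le\mathbf{x}\le\mathbf{x}'$ elementwise), then at least one Wardrop equilibrium exists. (2)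 Let $\mathbf{C}=(C_i^t,C_i^c,\gamma_i : i\in I)$ be any vector of cost coefficients with $C_i^t>0$, $C_i^c>0$ and $\gamma_i\ge 1$, and let, for $\{i,j\}=\{1,2\}$, $$J_i^s(\mathbf{x})=C_i^t\,(x_i^s+x_j^b)+C_i^c\,x_i^b\,(x_i^s+x_j^b),\qquad J_i^b(\mathbf{x})=C_j^t\,(x_j^s+\gamma_i x_i^b)+C_j^c\,x_j^b\,(x_j^s+x_i^b).$$ Then at least one Wardrop equilibrium exists. -/

import Mathlib

/-- A normalized demand configuration `F = {f₁, f₂}` of a diverge with two exit links (indexed by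
`Fin 2`): `f i` is the fraction of the (positive) total demand that wishes to take exit `i`. -/
structure DemandConfig where
  f : Fin 2 → ℝ
  nonneg : ∀ i, 0 ≤ f i
  sum_eq_one : f 0 + f 1 = 1

/-- A flow vector `x = (x_i^s, x_i^b : i ∈ I)`, stored as the pair of the vector of steadfast flows
and the vector of bypassing flows. The order is the elementwise one, and the topology is the
usual one of `ℝ⁴`. -/
abbrev FlowVector : Type := (Fin 2 → ℝ) × (Fin 2 → ℝ)

/-- The steadfast flow `x_i^s`. -/
abbrev FlowVector.s (x : FlowVector) (i : Fin 2) : ℝ := x.1 i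

/-- The bypassing flow `x_i^b`. -/
abbrev FlowVector.b (x : FlowVector) (i : Fin 2) : ℝ := x.2 i

/-- The flow vectors all of whose components are nonnegative. -/
abbrev FlowVector.orthant : Set FlowVector := Set.Ici 0

/-- Feasibility of a flow vector: conservation of flow, and nonnegativity. -/
def FlowVector.IsFeasible (F : DemandConfig) (x : FlowVector) : Prop :=
  ∀ i, F.f i = x.s i + x.b i ∧ 0 ≤ x.s i ∧ 0 ≤ x.b i

/-- `x` is a Wardrop equilibrium for the demand configuration `F` and the costs `Js i`
(of steadfast vehicles) and `Jb i` (of bypassing vehicles) of exit `i`. -/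
def IsWardropEquilibrium (F : DemandConfig) (Js Jb : Fin 2 → FlowVector → ℝ)
    (x : FlowVector) : Prop :=
  x.IsFeasible F ∧
    ∀ i, x.s i * (Js i x - Jb i x) ≤ 0 ∧ x.b i * (Jb i x - Js i x) ≤ 0

/-- A vector of cost coefficients `C = (C_i^t, C_i^c, γ_i : i ∈ I)`. -/
structure CostVector where
  Ct : Fin 2 → ℝ
  Cc : Fin 2 → ℝ
  γ : Fin 2 → ℝ
  Ct_pos : ∀ i, 0 < Ct i
  Cc_pos : ∀ i, 0 < Cc i
  one_le_γ : ∀ i, 1 ≤ γ i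

/-- The other exit: `0 ↦ 1` and `1 ↦ 0`. -/
def otherExit (i : Fin 2) : Fin 2 := i.rev

/-- The cost of the steadfast vehicles of exit `i`: with `j ≠ i` the other exit,
`C_i^t (x_i^s + x_j^b) + C_i^c x_i^b (x_i^s + x_j^b)`. -/
def CostVector.Js (C : CostVector) (i : Fin 2) (x : FlowVector) : ℝ :=
  C.Ct i * (x.s i + x.b (otherExit i)) + C.Cc i * x.b i * (x.s i + x.b (otherExit i))

/-- The cost of the bypassing vehicles of exit `i`: with `j ≠ i` the other exit,
`C_j^t (x_j^s + γ_i x_i^b) + C_j^c x_j^b (x_j^s + x_i^b)`. -/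
def CostVector.Jb (C : CostVector) (i : Fin 2) (x : FlowVector) : ℝ :=
  C.Ct (otherExit i) * (x.s (otherExit i) + C.γ i * x.b i) +
    C.Cc (otherExit i) * x.b (otherExit i) * (x.s (otherExit i) + x.b i)

/-!
Eliminating the steadfast flows through `x_i^s = f_i - x_i^b`, a Wardrop equilibrium is a solution
`t` of a complementarity problem on the rectangle `[0, f₀] × [0, f₁]`: with `G_i = J_i^s - J_i^b`,
one needs `G_i(t) ≤ 0` wherever `t_i < f_i` and `G_i(t) ≥ 0` wherever `0 < t_i`.
Such a point exists for continuous costs, among them the quadratic ones built from a cost vector.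

Let `P` be the projection of the plane onto the rectangle. A zero `u` of the continuous map
`u ↦ u - P u - G (P u)` gives the solution `t = P u`, because `u_i - t_i` is nonpositive if
`t_i < f_i` and nonnegative if `0 < t_i`. As `G` is bounded on the rectangle, each component of this
map is negative on one side and positive on the opposite side of a large square, so a zero exists
by the two-dimensional Poincaré–Miranda theorem (`exists_eq_zero_of_sign_on_sides`).

The latter is proved by lifting. A map from the plane to `ℂ \ {0}` has a continuous logarithm, since
`Complex.exp` is a covering of `ℂ \ {0}` and the plane is simply connected. The signs on the four
sides force its imaginary part to grow by `2 π` along the boundary of the rectangle, which is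
impossible for a function of the point.
-/

/-! ### The Poincaré–Miranda theorem in the plane -/

theorem ContinuousOn.mem_Ioo_of_forall_ne {θ : ℝ → ℝ} {a b x y c d : ℝ}
    (hθ : ContinuousOn θ (Set.Icc a b)) (hx : x ∈ Set.Icc a b) (hy : y ∈ Set.Icc a b)
    (hc : ∀ t ∈ Set.Icc a b, θ t ≠ c) (hd : ∀ t ∈ Set.Icc a b, θ t ≠ d)
    (h : θ x ∈ Set.Ioo c d) : θ y ∈ Set.Ioo c d := by
  have hord := (isPreconnected_Icc.image θ hθ).ordConnected
  have mx := Set.mem_image_of_mem θ hx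
  have my := Set.mem_image_of_mem θ hy
  constructor
  · by_contra! hcy
    obtain ⟨t, ht, hte⟩ := hord.out my mx ⟨hcy, h.1.le⟩
    exact hc t ht hte
  · by_contra! hdy
    obtain ⟨t, ht, hte⟩ := hord.out mx my ⟨h.2.le, hdy⟩
    exact hd t ht hte

/-- A nowhere vanishing pair of continuous functions on the plane has polar coordinates
with a continuous angle, which is chosen in `(0, π / 2)` at a point where both functions are positive. -/
theorem exists_continuous_angle {f g : ℝ × ℝ → ℝ} (hf : Continuous f) (hg : Continuous g)
    (hne : ∀ x, f x = 0 → g x ≠ 0) {x₀ : ℝ × ℝ} (hfx : 0 < f x₀) (hgx : 0 < g x₀) :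
    ∃ r θ : ℝ × ℝ → ℝ, Continuous θ ∧ (∀ x, 0 < r x) ∧ (∀ x, f x = r x * Real.cos (θ x)) ∧
      (∀ x, g x = r x * Real.sin (θ x)) ∧ θ x₀ ∈ Set.Ioo 0 (Real.pi / 2) := by
  let h : C(ℝ × ℝ, ℂ) := ⟨fun x => f x + g x * Complex.I, by fun_prop⟩
  have hre (x) : (h x).re = f x := by simp [h]
  have him (x) : (h x).im = g x := by simp [h]
  have h0 (x) : h x ≠ 0 := fun hx =>
    hne x (by rw [← hre, hx, Complex.zero_re]) (by rw [← him, hx, Complex.zero_im])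
  obtain ⟨L, ⟨hL₀, hL⟩, -⟩ := Complex.isCoveringMapOn_exp.existsUnique_continuousMap_lifts h
    (Complex.exp_log (h0 x₀)) (fun x => h0 x)
  have hexp (x) : Complex.exp (L x) = h x := congrFun hL x
  refine ⟨fun x => Real.exp (L x).re, fun x => (L x).im, by fun_prop, fun x => Real.exp_pos _,
    fun x => ?_, fun x => ?_, ?_⟩
  · rw [← Complex.exp_re, hexp, hre]
  · rw [← Complex.exp_im, hexp, him]
  · simp only [hL₀, Complex.log_im]
    constructor
    · have h1 : 0 ≤ (h x₀).arg := Complex.arg_nonneg_iff.2 (by rw [him]; exact hgx.le)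
      refine lt_of_le_of_ne h1 fun h2 => ?_
      have := (Complex.arg_eq_zero_iff.1 h2.symm).2
      rw [him] at this
      exact hgx.ne' this
    · exact (abs_lt.1 (Complex.abs_arg_lt_pi_div_two_iff.2 (.inl (by rwa [hre])))).2

/-- The **Poincaré–Miranda theorem** in the plane, with strict signs on the sides of the
rectangle. -/
theorem exists_eq_zero_of_sign_on_sides {f g : ℝ × ℝ → ℝ} (hf : Continuous f) (hg : Continuous g)
    {a b c d : ℝ} (hab : a ≤ b) (hcd : c ≤ d)
    (hfa : ∀ t ∈ Set.Icc c d, f (a, t) < 0) (hfb : ∀ t ∈ Set.Icc c d, 0 < f (b, t))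
    (hgc : ∀ t ∈ Set.Icc a b, g (t, c) < 0) (hgd : ∀ t ∈ Set.Icc a b, 0 < g (t, d)) :
    ∃ x, f x = 0 ∧ g x = 0 := by
  by_contra! hne
  have ha := Set.left_mem_Icc.2 hab
  have hb := Set.right_mem_Icc.2 hab
  have hc := Set.left_mem_Icc.2 hcd
  have hd := Set.right_mem_Icc.2 hcd
  obtain ⟨r, θ, hθ, hr, hfθ, hgθ, hbd⟩ := exists_continuous_angle hf hg hne (hfb d hd) (hgd b hb)
  have hπ := Real.pi_pos
  have hneg (x y) : r x * y < 0 ↔ y < 0 := by simp [mul_neg_iff, hr x, (hr x).not_gt]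
  simp only [hfθ, hgθ, mul_pos_iff_of_pos_left (hr _), hneg] at hfa hfb hgc hgd
  have hc3 : Real.cos (3 * Real.pi / 2) = 0 := by
    rw [show 3 * Real.pi / 2 = Real.pi / 2 + Real.pi by ring, Real.cos_add_pi, Real.cos_pi_div_two,
      neg_zero]
  have hc5 : Real.cos (5 * Real.pi / 2) = 0 := by
    rw [show 5 * Real.pi / 2 = Real.pi / 2 + 2 * Real.pi by ring, Real.cos_add_two_pi,
      Real.cos_pi_div_two]
  -- Follow the angle counterclockwise along the boundary, starting and ending at `(b, d)`.
  have htop : θ (a, d) ∈ Set.Ioo 0 Real.pi :=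
    ContinuousOn.mem_Ioo_of_forall_ne (θ := fun t => θ (t, d)) (by fun_prop) hb ha
      (fun t ht h => by simpa [h] using hgd t ht) (fun t ht h => by simpa [h] using hgd t ht)
      ⟨hbd.1, by linarith [hbd.2]⟩
  have had : Real.pi / 2 < θ (a, d) := by
    by_contra! h
    exact (hfa d hd).not_ge (Real.cos_nonneg_of_neg_pi_div_two_le_of_le (by linarith [htop.1]) h)
  have hleft : θ (a, c) ∈ Set.Ioo (Real.pi / 2) (3 * Real.pi / 2) :=
    ContinuousOn.mem_Ioo_of_forall_ne (θ := fun t => θ (a, t)) (by fun_prop) hd hc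
      (fun t ht h => by simpa [h] using hfa t ht) (fun t ht h => by simpa [h, hc3] using hfa t ht)
      ⟨had, by linarith [htop.2]⟩
  have hac : Real.pi < θ (a, c) := by
    by_contra! h
    exact (hgc a ha).not_ge (Real.sin_nonneg_of_nonneg_of_le_pi (by linarith [hleft.1]) h)
  have hbot : θ (b, c) ∈ Set.Ioo Real.pi (2 * Real.pi) :=
    ContinuousOn.mem_Ioo_of_forall_ne (θ := fun t => θ (t, c)) (by fun_prop) ha hb
      (fun t ht h => by simpa [h] using hgc t ht) (fun t ht h => by simpa [h] using hgc t ht)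
      ⟨hac, by linarith [hleft.2]⟩
  have hbc : 3 * Real.pi / 2 < θ (b, c) := by
    by_contra! h
    exact (hfb c hc).not_ge
      (Real.cos_nonpos_of_pi_div_two_le_of_le (by linarith [hbot.1]) (by linarith))
  have hright : θ (b, d) ∈ Set.Ioo (3 * Real.pi / 2) (5 * Real.pi / 2) :=
    ContinuousOn.mem_Ioo_of_forall_ne (θ := fun t => θ (b, t)) (by fun_prop) hc hd
      (fun t ht h => by simpa [h, hc3] using hfb t ht)
      (fun t ht h => by simpa [h, hc5] using hfb t ht)
      ⟨hbc, by linarith [hbot.2]⟩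
  linarith [hright.1, hbd.2]

/-! ### Complementarity on a rectangle -/

theorem complementarity_of_sub_projIcc_eq {p u y : ℝ} (hp : 0 ≤ p)
    (h : u - Set.projIcc 0 p hp u - y = 0) :
    (p - Set.projIcc 0 p hp u) * y ≤ 0 ∧ (Set.projIcc 0 p hp u : ℝ) * -y ≤ 0 := by
  rcases le_total u 0 with h0 | h0
  · rw [Set.projIcc_of_le_left hp h0] at h ⊢
    simp only [sub_zero, zero_mul, le_refl, and_true] at h ⊢
    exact mul_nonpos_of_nonneg_of_nonpos hp (by linarith)
  rcases le_total p u with h1 | h1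
  · rw [Set.projIcc_of_right_le hp h1] at h ⊢
    simp only [sub_self, zero_mul, le_refl, true_and] at h ⊢
    exact mul_nonpos_of_nonneg_of_nonpos hp (by linarith)
  · rw [Set.projIcc_of_mem hp ⟨h0, h1⟩] at h ⊢
    have hy : y = 0 := by simpa using h
    simp [hy]

/-- Continuous functions on a rectangle admit a point at which each of them is nonpositive off the
upper end, and nonnegative off the lower end, of the range of its own coordinate. -/
theorem exists_complementarity_of_continuousOn {p q : ℝ} (hp : 0 ≤ p) (hq : 0 ≤ q)
    {G₀ G₁ : ℝ × ℝ → ℝ} (hG₀ : ContinuousOn G₀ (Set.Icc 0 p ×ˢ Set.Icc 0 q))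
    (hG₁ : ContinuousOn G₁ (Set.Icc 0 p ×ˢ Set.Icc 0 q)) :
    ∃ t ∈ Set.Icc 0 p ×ˢ Set.Icc 0 q, ((p - t.1) * G₀ t ≤ 0 ∧ t.1 * -G₀ t ≤ 0) ∧
      ((q - t.2) * G₁ t ≤ 0 ∧ t.2 * -G₁ t ≤ 0) := by
  let P : ℝ × ℝ → ℝ × ℝ := fun u => (Set.projIcc 0 p hp u.1, Set.projIcc 0 q hq u.2)
  have hP : Continuous P := by
    refine .prodMk ?_ ?_
    · exact continuous_subtype_val.comp (continuous_projIcc.comp continuous_fst)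
    · exact continuous_subtype_val.comp (continuous_projIcc.comp continuous_snd)
  have hmem (u) : P u ∈ Set.Icc 0 p ×ˢ Set.Icc 0 q :=
    ⟨(Set.projIcc 0 p hp u.1).2, (Set.projIcc 0 q hq u.2).2⟩
  have hK : IsCompact (Set.Icc 0 p ×ˢ Set.Icc 0 q) := isCompact_Icc.prod isCompact_Icc
  obtain ⟨M₀, hM₀⟩ := hK.exists_bound_of_continuousOn hG₀
  obtain ⟨M₁, hM₁⟩ := hK.exists_bound_of_continuousOn hG₁
  have hb₀ (u) := abs_le.1 (hM₀ _ (hmem u))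
  have hb₁ (u) := abs_le.1 (hM₁ _ (hmem u))
  have hM₀0 : 0 ≤ M₀ := by linarith [hb₀ 0]
  have hM₁0 : 0 ≤ M₁ := by linarith [hb₁ 0]
  -- Beyond this size, a coordinate dominates both its projection and the value of `G₀` or `G₁`.
  let R : ℝ := p + q + M₀ + M₁ + 1
  have hR : -R ≤ R := by simp only [R]; linarith
  obtain ⟨u, hu₀, hu₁⟩ := exists_eq_zero_of_sign_on_sides
    (f := fun u => u.1 - (P u).1 - G₀ (P u)) (g := fun u => u.2 - (P u).2 - G₁ (P u))
    ((continuous_fst.sub hP.fst).sub (hG₀.comp_continuous hP hmem))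
    ((continuous_snd.sub hP.snd).sub (hG₁.comp_continuous hP hmem)) hR hR
    (fun t _ => by
      simp only [R]; linarith [(hmem (-R, t)).1.1, (hb₀ (-R, t)).1])
    (fun t _ => by
      simp only [R]; linarith [(hmem (R, t)).1.2, (hb₀ (R, t)).2])
    (fun t _ => by
      simp only [R]; linarith [(hmem (t, -R)).2.1, (hb₁ (t, -R)).1])
    (fun t _ => by
      simp only [R]; linarith [(hmem (t, R)).2.2, (hb₁ (t, R)).2])
  exact ⟨P u, hmem u, complementarity_of_sub_projIcc_eq hp hu₀,
    complementarity_of_sub_projIcc_eq hq hu₁⟩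

/-! ### Wardrop equilibria -/

theorem exists_isWardropEquilibrium_of_continuousOn (F : DemandConfig)
    {Js Jb : Fin 2 → FlowVector → ℝ} (hJs : ∀ i, ContinuousOn (Js i) FlowVector.orthant)
    (hJb : ∀ i, ContinuousOn (Jb i) FlowVector.orthant) :
    ∃ x : FlowVector, IsWardropEquilibrium F Js Jb x := by
  -- The flow vector that satisfies conservation of flow and has bypassing flows `t`.
  let X : ℝ × ℝ → FlowVector := fun t => (![F.f 0 - t.1, F.f 1 - t.2], ![t.1, t.2])
  have hX : Continuous X := by
    refine .prodMk (continuous_pi fun i => ?_) (continuous_pi fun i => ?_) <;>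
      fin_cases i <;> simp <;> fun_prop
  have hmaps : Set.MapsTo X (Set.Icc 0 (F.f 0) ×ˢ Set.Icc 0 (F.f 1)) FlowVector.orthant := by
    rintro ⟨s, t⟩ ⟨hs, ht⟩
    refine ⟨fun i => ?_, fun i => ?_⟩ <;> fin_cases i
    exacts [sub_nonneg.2 hs.2, sub_nonneg.2 ht.2, hs.1, ht.1]
  have hG (i) : ContinuousOn (fun t => Js i (X t) - Jb i (X t))
      (Set.Icc 0 (F.f 0) ×ˢ Set.Icc 0 (F.f 1)) :=
    ((hJs i).comp hX.continuousOn hmaps).sub ((hJb i).comp hX.continuousOn hmaps)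
  obtain ⟨t, ht, h₀, h₁⟩ := exists_complementarity_of_continuousOn (F.nonneg 0) (F.nonneg 1)
    (hG 0) (hG 1)
  simp only [neg_sub] at h₀ h₁
  refine ⟨X t, fun i => ⟨?_, (hmaps ht).1 i, (hmaps ht).2 i⟩, Fin.forall_fin_two.2 ⟨h₀, h₁⟩⟩
  fin_cases i <;> exact (sub_add_cancel _ _).symm

theorem mainTheorem3 (F : DemandConfig) :
    (∀ Js Jb : Fin 2 → FlowVector → ℝ,
      (∀ i, ContinuousOn (Js i) FlowVector.orthant) →
      (∀ i, ContinuousOn (Jb i) FlowVector.orthant) →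
      (∀ i, MonotoneOn (Js i) FlowVector.orthant) →
      (∀ i, MonotoneOn (Jb i) FlowVector.orthant) →
      ∃ x : FlowVector, IsWardropEquilibrium F Js Jb x) ∧
    (∀ C : CostVector, ∃ x : FlowVector, IsWardropEquilibrium F C.Js C.Jb x) := by
  refine ⟨fun Js Jb hJs hJb _ _ => exists_isWardropEquilibrium_of_continuousOn F hJs hJb,
    fun C => exists_isWardropEquilibrium_of_continuousOn F (fun i => ?_) (fun i => ?_)⟩
  · unfold CostVector.Js
    fun_prop
  · unfold CostVector.Jb
    fun_prop
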